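/- **Theorem 2 (Algorithm H1, limiting expression).** Consider a slotted multichannel random access system with $M\ge 1$ channels and single-replica transmission. In each slot, the devices that are active are the backlogged ones (activated in previous slots and not yet served) and the newly activated ones; the number of new ones is Poisson with mean $\lambda M$, independently from slot to slot. If $N$ devices are active, each of them, independently, transmits with probability $p=\min(1,M/N)$ on a channel chosen uniformly among the $M$ channels. A transmission succeeds if no other device transmits on the same channel and the message is not corrupted by the radio channel, which happens independently with probability $\gamma\in[0,1)$. Devices that succeed leave the system; all others are backlogged in the next slot. Let the load per channel satisfy $0\le\lambda<(1-\gamma)e^{-1}$. Then for every $M\ge1$ the Markov chain of the number of backlogged devices has a unique stationary distribution, it has a finite mean $B_M$, and the limiting average number of backlogged devices per channel is $$\eta^*=\lim_{M\to\infty}\frac{B_M}{M}=-W\!\left(-\frac{\lambda}{1-\gamma}\right)-\lambda,$$ where $W$ is the principal branch of the Lambert function, i.e. for $x\ge -e^{-1}$, $W(x)$ is the unique $w\ge-1$ with $we^{w}=x$. -/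

import Mathlib

open MeasureTheory ProbabilityTheory Filter Topology
open scoped NNReal ENNReal

noncomputable section

/-- The principal branch of the Lambert function: the inverse of `w ↦ w * exp w` restricted to
`[-1, ∞)`. It is meaningful for `x ≥ -exp (-1)`, see `lambertW_spec` and `lambertW_unique`. -/
def lambertW (x : ℝ) : ℝ :=
  Function.invFunOn (fun w : ℝ => w * Real.exp w) (Set.Ici (-1)) x

theorem lambertW_spec {x : ℝ} (hx : -Real.exp (-1) ≤ x) :
    -1 ≤ lambertW x ∧ lambertW x * Real.exp (lambertW x) = x := by
  have hex : ∃ w ∈ Set.Ici (-1 : ℝ), (fun w : ℝ => w * Real.exp w) w = x := by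
    have hle : (-1 : ℝ) ≤ max x 0 := le_trans (by norm_num) (le_max_right x 0)
    have hc : ContinuousOn (fun w : ℝ => w * Real.exp w) (Set.Icc (-1) (max x 0)) := by
      fun_prop
    have h0 : 0 ≤ max x 0 := le_max_right x 0
    have h1 : 1 ≤ Real.exp (max x 0) := Real.one_le_exp h0
    have hmem : x ∈ Set.Icc ((fun w : ℝ => w * Real.exp w) (-1))
        ((fun w : ℝ => w * Real.exp w) (max x 0)) := by
      refine ⟨by simpa using hx, ?_⟩
      have h2 : x ≤ max x 0 := le_max_left x 0
      change x ≤ max x 0 * Real.exp (max x 0)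
      nlinarith
    obtain ⟨w, hw, hwx⟩ := intermediate_value_Icc hle hc hmem
    exact ⟨w, hw.1, hwx⟩
  exact ⟨Function.invFunOn_mem hex, Function.invFunOn_eq hex⟩

theorem lambertW_unique {w : ℝ} (hw : -1 ≤ w) : lambertW (w * Real.exp w) = w := by
  have hmono : StrictMonoOn (fun w : ℝ => w * Real.exp w) (Set.Ici (-1)) := by
    refine strictMonoOn_of_deriv_pos (convex_Ici _) (by fun_prop) ?_
    intro y hy
    rw [interior_Ici, Set.mem_Ioi] at hy
    have hd : HasDerivAt (fun w : ℝ => w * Real.exp w)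
        (1 * Real.exp y + y * Real.exp y) y := (hasDerivAt_id y).mul (Real.hasDerivAt_exp y)
    rw [hd.deriv]
    nlinarith [Real.exp_pos y]
  exact hmono.injOn.leftInvOn_invFunOn hw

namespace RandomAccess

/-- What one active device does in one slot: whether it transmits, which of the `M` channels it
selects, and whether the radio channel would corrupt its replica. -/
abbrev Action (M : ℕ) : Type := Bool × Fin M × Bool

/-- The law of the action of one device: it transmits with probability `p`, selects a channel
uniformly, and the replica is corrupted with probability `γ`, all independently. -/
def actionLaw (M : ℕ) (p γ : unitInterval) : Measure (Action M) :=
  (bernoulliMeasure true false p).prod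
    ((uniformOn (Set.univ : Set (Fin M))).prod (bernoulliMeasure true false γ))

/-- The message of device `i` is delivered: the device transmits, no other device transmits on the
same channel, and the replica is not corrupted. -/
def Delivered {M n : ℕ} (ω : Fin n → Action M) (i : Fin n) : Prop :=
  (ω i).1 = true ∧ (∀ j, j ≠ i → (ω j).1 = true → (ω j).2.1 ≠ (ω i).2.1) ∧ (ω i).2.2 = false

open Classical in
/-- The number of devices whose message is delivered in the slot. -/
def deliveredCount {M n : ℕ} (ω : Fin n → Action M) : ℕ :=
  (Finset.univ.filter fun i => Delivered ω i).card

/-- The transmission probability `min (1, M / n)` of the algorithm, when `n` devices are active.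
(For `n = 0` there is no device and the value is irrelevant.) -/
def transmitProb (M n : ℕ) : unitInterval :=
  ⟨min 1 ((M : ℝ) / n), le_min zero_le_one (by positivity), min_le_left _ _⟩

/-- The law of the number of devices that stay in the system after a slot with `n` active devices,
which act independently. Those whose message is delivered leave. -/
def slotLaw (M : ℕ) (γ : unitInterval) (n : ℕ) : Measure ℕ :=
  (Measure.pi fun _ : Fin n => actionLaw M (transmitProb M n) γ).map
    fun ω => n - deliveredCount ω

/-- The transition kernel of the backlog (the number of active devices that were activated in
previous slots and not yet served) from one slot to the next: from backlog `b`, an independent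
Poisson number `a` of newly activated devices, of mean `lam * M`, joins, the `b + a` active devices
go through the slot, and those not served form the next backlog. -/
def backlogKernel (M : ℕ) (γ : unitInterval) (lam : ℝ≥0) : Kernel ℕ ℕ :=
  Kernel.ofFunOfCountable fun b =>
    (poissonMeasure (lam * M)).bind fun a => slotLaw M γ (b + a)

/-- `π` is a stationary distribution of the backlog. -/
def IsStationary (M : ℕ) (γ : unitInterval) (lam : ℝ≥0) (π : Measure ℕ) : Prop :=
  IsProbabilityMeasure π ∧ Kernel.Invariant (backlogKernel M γ lam) π

end RandomAccess

end

/-!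
Let `n` devices be active, `c = 1 - γ`, and `p = min 1 (M / n)`. Expanding the number `D` of
deliveries as a sum of products of functions of single devices gives
`E D = n p c (1 - p / M) ^ (n - 1)` and `E D ^ 2 ≤ E D + (E D) ^ 2`
(`integral_deliveredCount`, `integral_deliveredCount_sq_le`). Up to one device,
`E D` equals `c M f (n / M)`, where `f x = y exp (-y)` with `y = min x 1`
(`throughput_le_meanSingles`). The function `f` is nondecreasing and `1`-Lipschitz on `[0, ∞)`, and
strictly increasing up to `1`. The equation `c f x₀ = λ` has the solution
`x₀ = -W (-λ / c) < 1`, so `x₀ M` active devices, that is, a backlog of `(x₀ - λ) M`, is the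
equilibrium.

The squared distance of the backlog to this equilibrium is a Lyapunov function. With
`u = n - x₀ M` and `w = c M (f (n / M) - f x₀)`, its mean after a slot with `n` active devices is at
most `(u - w) ^ 2 + O(M) ≤ u ^ 2 - u w + O(M)`, since `0 ≤ w ^ 2 ≤ u w`; and `u w` is at least
`κ M (|u| - ε M)` for some `κ > 0` that does not depend on `M` and `n`. Averaging over the Poisson arrivals
adds only their variance `λ M` (`exists_drift_backlogKernel`).

The Foster–Lyapunov criterion `exists_invariant_of_drift` turns this into a stationary law `π` with
`κ M E|B - (x₀ - λ) M| ≤ O(M) + κ ε M ^ 2`, for every `ε` with its own `κ`. So the mean is finite,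
and division by `κ M ^ 2` gives `B_M / M → x₀ - λ`. The stationary law is unique since
the backlog can decrease from every positive state (`invariant_unique`).
-/

/-! ### Invariant laws of Markov chains on `ℕ` -/

namespace CountableChain

theorem measure_le_of_singleton {μ ν : Measure ℕ} (h : ∀ k, μ {k} ≤ ν {k}) : μ ≤ ν := by
  intro s
  rw [← Measure.sum_smul_dirac μ, ← Measure.sum_smul_dirac ν,
    Measure.sum_apply _ (MeasurableSet.of_discrete), Measure.sum_apply _ (MeasurableSet.of_discrete)]
  refine ENNReal.tsum_le_tsum fun k => ?_
  rw [Measure.smul_apply, Measure.smul_apply, smul_eq_mul, smul_eq_mul]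
  exact mul_le_mul_left (h k) _

theorem bind_univ (K : Kernel ℕ ℕ) [IsMarkovKernel K] (μ : Measure ℕ) :
    μ.bind K Set.univ = μ Set.univ := by
  rw [Measure.bind_apply MeasurableSet.univ K.aemeasurable]
  simp

theorem bind_mono (K : Kernel ℕ ℕ) {μ ν : Measure ℕ} (h : μ ≤ ν) : μ.bind K ≤ ν.bind K := by
  refine measure_le_of_singleton fun k => ?_
  rw [Measure.bind_apply (.singleton k) K.aemeasurable,
    Measure.bind_apply (.singleton k) K.aemeasurable]
  exact lintegral_mono' h le_rfl

theorem add_bind (K : Kernel ℕ ℕ) (μ ν : Measure ℕ) :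
    (μ + ν).bind K = μ.bind K + ν.bind K := by
  refine Measure.ext fun s hs => ?_
  simp [Measure.bind_apply hs K.aemeasurable]

/-- A sub-invariant finite measure of a Markov kernel is invariant, because the kernel preserves the
total mass. -/
theorem invariant_of_bind_le (K : Kernel ℕ ℕ) [IsMarkovKernel K] {μ : Measure ℕ}
    [IsFiniteMeasure μ] (h : ∀ k, μ.bind K {k} ≤ μ {k}) : Kernel.Invariant K μ := by
  have : IsFiniteMeasure (μ.bind K) := ⟨by rw [bind_univ]; exact measure_lt_top _ _⟩
  exact Measure.eq_of_le_of_measure_univ_eq (measure_le_of_singleton h) (bind_univ K μ)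

/-- If the chain can move downwards from every positive state, a non-zero invariant measure charges
the state `0`. -/
theorem eq_zero_of_invariant (K : Kernel ℕ ℕ)
    (hK : ∀ b, b ≠ 0 → ∃ c < b, K b {c} ≠ 0) {μ : Measure ℕ}
    (hμ : Kernel.Invariant K μ) (h0 : μ {0} = 0) : μ = 0 := by
  refine Measure.ext_of_singleton fun b => ?_
  rw [Measure.coe_zero, Pi.zero_apply]
  induction b using Nat.strong_induction_on with
  | _ b ih =>
    rcases eq_or_ne b 0 with rfl | hb
    · exact h0
    obtain ⟨c, hc, hbc⟩ := hK b hb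
    have h1 := ih c hc
    rw [← hμ.def, Measure.bind_apply (.singleton c) K.aemeasurable, lintegral_countable',
      ENNReal.tsum_eq_zero] at h1
    exact (mul_eq_zero.1 (h1 b)).resolve_left hbc

/-- A Markov chain on `ℕ` that can move downwards from every positive state has at most one
invariant law. The pointwise minimum of two invariant laws is invariant; removing it from
the law with the smaller mass at `0` leaves an invariant measure that does not charge `0`. -/
theorem invariant_unique (K : Kernel ℕ ℕ) [IsMarkovKernel K]
    (hK : ∀ b, b ≠ 0 → ∃ c < b, K b {c} ≠ 0) {μ ν : Measure ℕ}
    [IsProbabilityMeasure μ] [IsProbabilityMeasure ν]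
    (hμ : Kernel.Invariant K μ) (hν : Kernel.Invariant K ν) : μ = ν := by
  wlog h0 : μ {0} ≤ ν {0} generalizing μ ν
  · exact (this hν hμ (le_of_not_ge h0)).symm
  set m : Measure ℕ := Measure.sum fun k => (min (μ {k}) (ν {k})) • Measure.dirac k with hm
  have hmk (k : ℕ) : m {k} = min (μ {k}) (ν {k}) := Measure.sum_smul_dirac_singleton
  have hmμ : m ≤ μ := measure_le_of_singleton fun k => (hmk k).trans_le (min_le_left _ _)
  have hmν : m ≤ ν := measure_le_of_singleton fun k => (hmk k).trans_le (min_le_right _ _)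
  have : IsFiniteMeasure m := isFiniteMeasure_of_le μ hmμ
  have hinv : Kernel.Invariant K m := by
    refine invariant_of_bind_le K fun k => ?_
    rw [hmk]
    refine le_min ?_ ?_
    · exact (bind_mono K hmμ {k}).trans_eq (by rw [hμ.def])
    · exact (bind_mono K hmν {k}).trans_eq (by rw [hν.def])
  have hsub : μ - m + m = μ := Measure.sub_add_cancel_of_le hmμ
  have hdiff : Kernel.Invariant K (μ - m) := by
    have h1 : (μ - m).bind K + m = (μ - m) + m := by
      calc (μ - m).bind K + m = (μ - m).bind K + m.bind K := by rw [hinv.def]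
        _ = (μ - m) + m := by rw [← add_bind, hsub, hμ.def]
    refine Measure.ext_of_singleton fun k => ?_
    have h2 := congrArg (fun ρ : Measure ℕ => ρ {k}) h1
    simp only [Measure.coe_add, Pi.add_apply] at h2
    exact (ENNReal.add_left_inj (measure_ne_top m {k})).1 h2
  have hz : (μ - m) {0} = 0 := by
    rw [Measure.sub_apply (.singleton 0) hmμ, hmk, min_eq_left h0, tsub_self]
  have hle : μ ≤ ν := by
    rw [← hsub, eq_zero_of_invariant K hK hdiff hz, zero_add]
    exact hmν
  exact Measure.eq_of_le_of_isProbabilityMeasure hle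

/-- Fatou's lemma along a filter, for pointwise convergence of the masses of the points. -/
theorem lintegral_le_of_tendsto {l : Filter ℕ} [l.NeBot] {ν : ℕ → Measure ℕ} {π : Measure ℕ}
    (h : ∀ k, Tendsto (fun T => ν T {k}) l (𝓝 (π {k}))) {f : ℕ → ℝ≥0∞} (hf : ∀ k, f k ≠ ∞)
    {c : ℕ → ℝ≥0∞} {C : ℝ≥0∞} (hc : Tendsto c l (𝓝 C)) (hle : ∀ᶠ T in l, ∫⁻ k, f k ∂ν T ≤ c T) :
    ∫⁻ k, f k ∂π ≤ C := by
  rw [lintegral_countable', ENNReal.tsum_eq_iSup_sum]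
  refine iSup_le fun s => ?_
  refine le_of_tendsto_of_tendsto (b := l) (tendsto_finsetSum s fun k _ =>
    ENNReal.Tendsto.const_mul (h k) (Or.inr (hf k))) hc ?_
  filter_upwards [hle] with T hT
  refine le_trans ?_ hT
  rw [lintegral_countable']
  exact ENNReal.sum_le_tsum s

/-- The law after `t` steps of the chain started at `0`. -/
noncomputable def law (K : Kernel ℕ ℕ) : ℕ → Measure ℕ
  | 0 => Measure.dirac 0
  | t + 1 => (law K t).bind K

/-- The average of the laws of the chain started at `0` over the times `0, …, T - 1`. -/
noncomputable def cesaro (K : Kernel ℕ ℕ) (T : ℕ) : Measure ℕ :=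
  (T : ℝ≥0∞)⁻¹ • ∑ t ∈ Finset.range T, law K t

instance (K : Kernel ℕ ℕ) [IsMarkovKernel K] (t : ℕ) : IsProbabilityMeasure (law K t) := by
  induction t with
  | zero => exact Measure.dirac.isProbabilityMeasure
  | succ t ih => exact ⟨by rw [law, bind_univ]; exact ih.measure_univ⟩

theorem lintegral_cesaro (K : Kernel ℕ ℕ) (T : ℕ) (f : ℕ → ℝ≥0∞) :
    ∫⁻ k, f k ∂cesaro K T = (T : ℝ≥0∞)⁻¹ * ∑ t ∈ Finset.range T, ∫⁻ k, f k ∂law K t := by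
  rw [cesaro, lintegral_smul_measure, lintegral_finsetSum_measure, smul_eq_mul]

/-- Summing a drift inequality along the trajectory. -/
theorem sum_lintegral_le_of_drift (K : Kernel ℕ ℕ) [IsMarkovKernel K] {V W : ℕ → ℝ≥0∞} {C : ℝ≥0∞}
    (hd : ∀ b, ∫⁻ k, V k ∂K b + W b ≤ V b + C) (T : ℕ) :
    ∫⁻ k, V k ∂law K T + ∑ t ∈ Finset.range T, ∫⁻ k, W k ∂law K t ≤ V 0 + T * C := by
  induction T with
  | zero => simp [law]
  | succ T ih =>
    have h1 : ∫⁻ k, V k ∂law K (T + 1) + ∫⁻ k, W k ∂law K T ≤ ∫⁻ k, V k ∂law K T + C := by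
      rw [law, Measure.lintegral_bind K.aemeasurable (by fun_prop),
        ← lintegral_add_left (by fun_prop)]
      refine (lintegral_mono hd).trans_eq ?_
      rw [lintegral_add_left (by fun_prop)]
      simp
    rw [Finset.sum_range_succ]
    calc _ = (∫⁻ k, V k ∂law K (T + 1) + ∫⁻ k, W k ∂law K T)
          + ∑ t ∈ Finset.range T, ∫⁻ k, W k ∂law K t := by ring
      _ ≤ (∫⁻ k, V k ∂law K T + C) + ∑ t ∈ Finset.range T, ∫⁻ k, W k ∂law K t := by gcongr
      _ = (∫⁻ k, V k ∂law K T + ∑ t ∈ Finset.range T, ∫⁻ k, W k ∂law K t) + C := by ring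
      _ ≤ V 0 + T * C + C := by gcongr
      _ = _ := by push_cast; ring

theorem lintegral_cesaro_le (K : Kernel ℕ ℕ) [IsMarkovKernel K] {V W : ℕ → ℝ≥0∞} {C : ℝ≥0∞}
    (hd : ∀ b, ∫⁻ k, V k ∂K b + W b ≤ V b + C) {T : ℕ} (hT : T ≠ 0) :
    ∫⁻ k, W k ∂cesaro K T ≤ (T : ℝ≥0∞)⁻¹ * V 0 + C := by
  rw [lintegral_cesaro]
  calc _ ≤ (T : ℝ≥0∞)⁻¹ * (V 0 + T * C) := by
        gcongr
        exact le_add_self.trans (sum_lintegral_le_of_drift K hd T)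
    _ = _ := by
        rw [mul_add, ← mul_assoc, ENNReal.inv_mul_cancel (by simpa using hT) (by simp), one_mul]

theorem cesaro_univ (K : Kernel ℕ ℕ) [IsMarkovKernel K] {T : ℕ} (hT : T ≠ 0) :
    cesaro K T Set.univ = 1 := by
  have := lintegral_cesaro K T (fun _ => 1)
  simp only [lintegral_const, measure_univ, mul_one, one_mul, Finset.sum_const, Finset.card_range,
    nsmul_eq_mul] at this
  rw [this, ENNReal.inv_mul_cancel (by simpa using hT) (by simp)]

theorem lintegral_kernel_cesaro_le (K : Kernel ℕ ℕ) [IsMarkovKernel K] (T k : ℕ) :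
    ∫⁻ b, K b {k} ∂cesaro K T ≤ cesaro K T {k} + (T : ℝ≥0∞)⁻¹ := by
  have h1 (t : ℕ) : ∫⁻ b, K b {k} ∂law K t = law K (t + 1) {k} := by
    rw [law, Measure.bind_apply (.singleton k) K.aemeasurable]
  have h2 : ∑ t ∈ Finset.range T, law K (t + 1) {k} ≤
      ∑ t ∈ Finset.range T, law K t {k} + 1 := by
    refine le_self_add.trans ((Finset.sum_range_succ' (fun t => law K t {k}) T).symm.trans
      (Finset.sum_range_succ _ T)).le |>.trans ?_
    gcongr
    exact prob_le_one
  have h3 : cesaro K T {k} = (T : ℝ≥0∞)⁻¹ * ∑ t ∈ Finset.range T, law K t {k} := by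
    simp [cesaro]
  rw [lintegral_cesaro, h3]
  simp_rw [h1]
  refine (mul_le_mul_right h2 _).trans_eq ?_
  rw [mul_add, mul_one]

/-- **Foster–Lyapunov criterion.** If a drift inequality holds for one function `W` with finite
sublevel sets, the Markov chain has an invariant law `π` that satisfies `∫ W ≤ C` for all drift
inequalities `K V + W ≤ V + C` at once. The law is a limit along an ultrafilter of the averages
of the laws of the chain started at `0`. -/
theorem exists_invariant_of_drift (K : Kernel ℕ ℕ) [IsMarkovKernel K] {V₀ W₀ : ℕ → ℝ≥0∞}
    {C₀ : ℝ≥0∞} (hV₀ : V₀ 0 ≠ ∞) (hC₀ : C₀ ≠ ∞) (hW₀ : ∀ R : ℕ, {b | W₀ b < R}.Finite)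
    (hd₀ : ∀ b, ∫⁻ k, V₀ k ∂K b + W₀ b ≤ V₀ b + C₀) :
    ∃ π : Measure ℕ, IsProbabilityMeasure π ∧ Kernel.Invariant K π ∧
      ∀ (V W : ℕ → ℝ≥0∞) (C : ℝ≥0∞), V 0 ≠ ∞ → (∀ b, W b ≠ ∞) →
        (∀ b, ∫⁻ k, V k ∂K b + W b ≤ V b + C) → ∫⁻ b, W b ∂π ≤ C := by
  set U : Ultrafilter ℕ := hyperfilter ℕ with hU
  have hUtop : (U : Filter ℕ) ≤ atTop := by
    rw [← Nat.cofinite_eq_atTop]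
    exact hyperfilter_le_cofinite
  have hlim (k : ℕ) : ∃ a, Tendsto (fun T => cesaro K T {k}) U (𝓝 a) := by
    obtain ⟨a, -, ha⟩ := isCompact_univ.ultrafilter_le_nhds
      (U.map fun T => cesaro K T {k}) (by simp)
    exact ⟨a, ha⟩
  choose a ha using hlim
  set π : Measure ℕ := Measure.sum fun k => a k • Measure.dirac k
  have hπ (k : ℕ) : π {k} = a k := Measure.sum_smul_dirac_singleton
  have hconv (k : ℕ) : Tendsto (fun T => cesaro K T {k}) U (𝓝 (π {k})) := by
    rw [hπ]; exact ha k
  have hne : ∀ᶠ T : ℕ in U, T ≠ 0 := hUtop (eventually_ne_atTop 0)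
  have hinv : Tendsto (fun T : ℕ => (T : ℝ≥0∞)⁻¹) U (𝓝 0) :=
    ENNReal.tendsto_inv_nat_nhds_zero.mono_left hUtop
  have hVlim {v : ℝ≥0∞} (hv : v ≠ ∞) (C : ℝ≥0∞) :
      Tendsto (fun T : ℕ => (T : ℝ≥0∞)⁻¹ * v + C) U (𝓝 C) := by
    simpa using (ENNReal.Tendsto.mul_const hinv (Or.inr hv)).add_const C
  have hle1 : π Set.univ ≤ 1 := by
    rw [← lintegral_one]
    refine lintegral_le_of_tendsto hconv (by simp) tendsto_const_nhds ?_
    filter_upwards [hne] with T hT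
    rw [lintegral_one, cesaro_univ K hT]
  -- By Markov's inequality for `W₀`, no mass escapes to infinity.
  have hge (R : ℕ) (hR : R ≠ 0) : 1 ≤ π Set.univ + (R : ℝ≥0∞)⁻¹ * C₀ := by
    set F := (hW₀ R).toFinset
    have hsum : Tendsto (fun T => ∑ k ∈ F, cesaro K T {k} + (R : ℝ≥0∞)⁻¹ *
        ((T : ℝ≥0∞)⁻¹ * V₀ 0 + C₀)) U (𝓝 (∑ k ∈ F, π {k} + (R : ℝ≥0∞)⁻¹ * C₀)) := by
      refine (tendsto_finsetSum F fun k _ => hconv k).add ?_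
      exact ENNReal.Tendsto.const_mul (hVlim hV₀ C₀) (Or.inr (by simpa using hR))
    refine (ge_of_tendsto hsum ?_).trans ?_
    · filter_upwards [hne] with T hT
      have hM : cesaro K T {b | (R : ℝ≥0∞) ≤ W₀ b} ≤
          (R : ℝ≥0∞)⁻¹ * ((T : ℝ≥0∞)⁻¹ * V₀ 0 + C₀) := by
        have h1 := mul_meas_ge_le_lintegral (μ := cesaro K T) (f := W₀) (by fun_prop) (R : ℝ≥0∞)
        have h2 := h1.trans (lintegral_cesaro_le K hd₀ hT)
        rw [mul_comm, ← div_eq_mul_inv]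
        rw [ENNReal.le_div_iff_mul_le (by simp [hR]) (by simp), mul_comm]
        exact h2
      rw [← cesaro_univ K hT, sum_measure_singleton]
      refine le_trans (le_trans (measure_mono ?_) (measure_union_le (F : Set ℕ) _))
        (add_le_add_right hM _)
      intro b _
      rcases lt_or_ge (W₀ b) R with h | h
      · exact Or.inl (by simpa [F] using h)
      · exact Or.inr h
    · rw [sum_measure_singleton]
      gcongr
      exact Set.subset_univ _
  have hge1 : 1 ≤ π Set.univ := by
    have h1 : Tendsto (fun R : ℕ => π Set.univ + (R : ℝ≥0∞)⁻¹ * C₀) atTop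
        (𝓝 (π Set.univ + 0 * C₀)) :=
      (ENNReal.Tendsto.mul_const ENNReal.tendsto_inv_nat_nhds_zero (Or.inr hC₀)).const_add _
    rw [zero_mul, add_zero] at h1
    refine ge_of_tendsto h1 ?_
    filter_upwards [eventually_ne_atTop 0] with R hR using hge R hR
  have hprob : IsProbabilityMeasure π := ⟨le_antisymm hle1 hge1⟩
  refine ⟨π, hprob, invariant_of_bind_le K fun k => ?_, fun V W C hV hW hd => ?_⟩
  · rw [Measure.bind_apply (.singleton k) K.aemeasurable]
    refine lintegral_le_of_tendsto hconv (fun b => measure_ne_top _ _)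
      (c := fun T => cesaro K T {k} + (T : ℝ≥0∞)⁻¹) ?_
      (Eventually.of_forall fun T => lintegral_kernel_cesaro_le K T k)
    simpa using (hconv k).add hinv
  · refine lintegral_le_of_tendsto hconv hW (hVlim hV C) ?_
    filter_upwards [hne] with T hT using lintegral_cesaro_le K hd hT

end CountableChain

/-! ### Moments of the number of delivered messages -/

namespace RandomAccess

instance (M : ℕ) [NeZero M] (p γ : unitInterval) : IsProbabilityMeasure (actionLaw M p γ) := by
  unfold actionLaw; infer_instance

theorem integral_actionLaw {M : ℕ} [NeZero M] (p γ : unitInterval) (h : Action M → ℝ) :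
    ∫ x, h x ∂actionLaw M p γ =
      p * ((M : ℝ)⁻¹ * ∑ k, (γ * h (true, k, true) + (1 - γ) * h (true, k, false))) +
      (1 - p) * ((M : ℝ)⁻¹ * ∑ k, (γ * h (false, k, true) + (1 - γ) * h (false, k, false))) := by
  have hunif (f : Fin M → ℝ) :
      ∫ k, f k ∂uniformOn (Set.univ : Set (Fin M)) = (M : ℝ)⁻¹ * ∑ k, f k := by
    rw [integral_fintype .of_finite, Finset.mul_sum]
    refine Finset.sum_congr rfl fun k _ => ?_
    rw [measureReal_def, uniformOn_univ]
    simp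
  rw [actionLaw, integral_prod _ .of_finite, integral_bernoulliMeasure]
  simp_rw [integral_prod _ (Integrable.of_finite (μ := (uniformOn (Set.univ : Set (Fin M))).prod
    (bernoulliMeasure true false γ))), integral_bernoulliMeasure, hunif]
  simp

/-- The indicator that a device transmits an uncorrupted replica on channel `k`. -/
def sends {M : ℕ} (k : Fin M) (x : Action M) : ℝ :=
  if x.1 = true ∧ x.2.1 = k ∧ x.2.2 = false then 1 else 0

/-- The indicator that a device does not transmit on channel `k`. -/
def avoids {M : ℕ} (k : Fin M) (x : Action M) : ℝ :=
  if x.1 = true ∧ x.2.1 = k then 0 else 1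

theorem integral_sends {M : ℕ} [NeZero M] (p γ : unitInterval) (k : Fin M) :
    ∫ x, sends k x ∂actionLaw M p γ = p / M * (1 - γ) := by
  rw [integral_actionLaw]
  simp [sends]
  ring

theorem integral_avoids {M : ℕ} [NeZero M] (p γ : unitInterval) (k : Fin M) :
    ∫ x, avoids k x ∂actionLaw M p γ = 1 - p / M := by
  have hM : (M : ℝ) ≠ 0 := NeZero.ne _
  have h (l : Fin M) : (if l = k then (0 : ℝ) else 1) = 1 - if l = k then 1 else 0 := by
    split_ifs <;> simp
  rw [integral_actionLaw]
  simp only [avoids, true_and, Bool.false_eq_true, false_and, if_false, h]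
  simp [Finset.sum_add_distrib, ← Finset.mul_sum]
  field_simp
  ring

theorem integral_avoids_mul_avoids {M : ℕ} [NeZero M] (p γ : unitInterval) {k l : Fin M}
    (hkl : k ≠ l) : ∫ x, avoids k x * avoids l x ∂actionLaw M p γ = 1 - 2 * (p / M) := by
  have hM : (M : ℝ) ≠ 0 := NeZero.ne _
  have h (j : Fin M) : ((if j = k then (0 : ℝ) else 1) * if j = l then (0 : ℝ) else 1)
      = 1 - (if j = k then 1 else 0) - if j = l then 1 else 0 := by
    split_ifs with h1 h2 h2
    · exact absurd (h1.symm.trans h2) hkl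
    all_goals simp
  rw [integral_actionLaw]
  simp only [avoids, true_and, Bool.false_eq_true, false_and, if_false, h]
  simp [Finset.sum_add_distrib, ← Finset.mul_sum]
  field_simp
  ring

/-- The law of the actions of `n` active devices, which are independent. -/
noncomputable abbrev actionsLaw (M n : ℕ) (p γ : unitInterval) : Measure (Fin n → Action M) :=
  Measure.pi fun _ => actionLaw M p γ

open Classical in
/-- The indicator that the message of device `i` is delivered. -/
noncomputable def deliv {M n : ℕ} (ω : Fin n → Action M) (i : Fin n) : ℝ := if Delivered ω i then 1 else 0

theorem cast_deliveredCount {M n : ℕ} (ω : Fin n → Action M) :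
    (deliveredCount ω : ℝ) = ∑ i, deliv ω i := by
  simp [deliveredCount, deliv]

theorem deliveredCount_le {M n : ℕ} (ω : Fin n → Action M) : deliveredCount ω ≤ n := by
  classical
  exact (Finset.card_filter_le _ _).trans_eq (by simp)

theorem deliv_eq_sum {M n : ℕ} (ω : Fin n → Action M) (i : Fin n) :
    deliv ω i = ∑ k, ∏ j, (if j = i then sends k else avoids k) (ω j) := by
  have hsplit (k : Fin M) : ∏ j, (if j = i then sends k else avoids k) (ω j) =
      sends k (ω i) * ∏ j ∈ Finset.univ.erase i, avoids k (ω j) := by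
    rw [← Finset.mul_prod_erase _ _ (Finset.mem_univ i), if_pos rfl]
    congr 1
    refine Finset.prod_congr rfl fun j hj => ?_
    rw [if_neg (Finset.ne_of_mem_erase hj)]
  simp_rw [hsplit]
  rw [Finset.sum_eq_single (ω i).2.1]
  · unfold deliv
    split_ifs with h
    · obtain ⟨h1, h2, h3⟩ := h
      rw [sends, if_pos ⟨h1, rfl, h3⟩, one_mul, Finset.prod_eq_one]
      intro j hj
      rw [avoids, if_neg fun h => h2 j (Finset.ne_of_mem_erase hj) h.1 h.2]
    · by_contra hne
      obtain ⟨hs, hp⟩ := mul_ne_zero_iff.1 (Ne.symm hne)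
      have hs' : (ω i).1 = true ∧ (ω i).2.1 = (ω i).2.1 ∧ (ω i).2.2 = false := by
        by_contra hc; exact hs (if_neg hc)
      refine h ⟨hs'.1, fun j hj h1 h2 => ?_, hs'.2.2⟩
      exact Finset.prod_ne_zero_iff.1 hp j (Finset.mem_erase.2 ⟨hj, Finset.mem_univ j⟩)
        (if_pos ⟨h1, h2⟩)
  · intro k _ hk
    rw [sends, if_neg fun h => hk h.2.1.symm, zero_mul]
  · simp

theorem integral_deliv {M n : ℕ} [NeZero M] (p γ : unitInterval) (i : Fin n) :
    ∫ ω, deliv ω i ∂actionsLaw M n p γ = p * (1 - γ) * (1 - p / M) ^ (n - 1) := by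
  have hM : (M : ℝ) ≠ 0 := NeZero.ne _
  simp_rw [deliv_eq_sum]
  rw [integral_finsetSum _ fun _ _ => .of_finite]
  have hterm (k : Fin M) : ∫ ω : Fin n → Action M,
      ∏ j, (if j = i then sends k else avoids k) (ω j) ∂actionsLaw M n p γ =
      p / M * (1 - γ) * (1 - p / M) ^ (n - 1) := by
    rw [integral_fintype_prod_eq_prod (f := fun j => if j = i then sends k else avoids k),
      ← Finset.mul_prod_erase _ _ (Finset.mem_univ i)]
    simp only [if_true, integral_sends]
    rw [Finset.prod_eq_pow_card (b := 1 - (p : ℝ) / M)]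
    · simp
    · intro j hj
      rw [if_neg (Finset.ne_of_mem_erase hj), integral_avoids]
  simp_rw [hterm]
  simp
  field_simp

/-- Two delivered messages use different channels, which none of the other devices uses. -/
theorem deliv_mul_deliv_le {M n : ℕ} (ω : Fin n → Action M) {i i' : Fin n} (hi : i' ≠ i) :
    deliv ω i * deliv ω i' ≤ ∑ k, ∑ l ∈ Finset.univ.erase k,
      ∏ j, (if j = i then sends k else if j = i' then sends l else
        fun x => avoids k x * avoids l x) (ω j) := by
  have hs0 (k : Fin M) (x : Action M) : 0 ≤ sends k x := by
    unfold sends; split_ifs <;> simp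
  have ha0 (k : Fin M) (x : Action M) : 0 ≤ avoids k x := by
    unfold avoids; split_ifs <;> simp
  have hnn (k l : Fin M) : 0 ≤ ∏ j, (if j = i then sends k else if j = i' then sends l else
        fun x => avoids k x * avoids l x) (ω j) := by
    refine Finset.prod_nonneg fun j _ => ?_
    split_ifs
    exacts [hs0 _ _, hs0 _ _, mul_nonneg (ha0 _ _) (ha0 _ _)]
  by_cases h : Delivered ω i ∧ Delivered ω i'
  · obtain ⟨h1, h2⟩ := h
    have hkl : (ω i').2.1 ≠ (ω i).2.1 := h1.2.1 i' hi h2.1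
    refine le_trans ?_ (Finset.single_le_sum (fun k _ => Finset.sum_nonneg fun l _ => hnn k l)
      (Finset.mem_univ (ω i).2.1))
    refine le_trans ?_ (Finset.single_le_sum (fun l _ => hnn _ l)
      (Finset.mem_erase.2 ⟨hkl, Finset.mem_univ _⟩))
    rw [deliv, if_pos h1, deliv, if_pos h2, Finset.prod_eq_one, one_mul]
    intro j _
    split_ifs with hj hj'
    · rw [hj, sends, if_pos ⟨h1.1, rfl, h1.2.2⟩]
    · rw [hj', sends, if_pos ⟨h2.1, rfl, h2.2.2⟩]
    · simp only [avoids]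
      rw [if_neg fun h => h1.2.1 j hj h.1 h.2, if_neg fun h => h2.2.1 j hj' h.1 h.2, one_mul]
  · have : deliv ω i * deliv ω i' = 0 := by
      rcases not_and_or.1 h with h | h <;> simp [deliv, h]
    rw [this]
    exact Finset.sum_nonneg fun k _ => Finset.sum_nonneg fun l _ => hnn k l

theorem integral_deliv_mul_deliv_le {M n : ℕ} [NeZero M] (p γ : unitInterval) {i i' : Fin n}
    (hi : i' ≠ i) : ∫ ω, deliv ω i * deliv ω i' ∂actionsLaw M n p γ ≤
      (p * (1 - γ)) ^ 2 * (1 - 1 / M) * (1 - 2 * (p / M)) ^ (n - 2) := by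
  have hM : (M : ℝ) ≠ 0 := NeZero.ne _
  refine (integral_mono .of_finite .of_finite fun ω => deliv_mul_deliv_le ω hi).trans_eq ?_
  rw [integral_finsetSum _ fun _ _ => .of_finite]
  simp_rw [integral_finsetSum _ fun _ _ =>
    Integrable.of_finite (μ := actionsLaw M n p γ)]
  have hterm (k l : Fin M) (hkl : k ≠ l) : ∫ ω : Fin n → Action M,
      ∏ j, (if j = i then sends k else if j = i' then sends l else
        fun x => avoids k x * avoids l x) (ω j) ∂actionsLaw M n p γ =
      (p / M * (1 - γ)) ^ 2 * (1 - 2 * (p / M)) ^ (n - 2) := by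
    rw [integral_fintype_prod_eq_prod (f := fun j => if j = i then sends k else
        if j = i' then sends l else fun x => avoids k x * avoids l x),
      ← Finset.mul_prod_erase _ _ (Finset.mem_univ i),
      ← Finset.mul_prod_erase _ _ (Finset.mem_erase.2 ⟨hi, Finset.mem_univ i'⟩)]
    simp only [if_true, hi, if_false, integral_sends]
    rw [Finset.prod_eq_pow_card (b := 1 - 2 * ((p : ℝ) / M))]
    · rw [Finset.card_erase_of_mem (Finset.mem_erase.2 ⟨hi, Finset.mem_univ i'⟩),
        Finset.card_erase_of_mem (Finset.mem_univ i), Finset.card_univ, Fintype.card_fin,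
        Nat.sub_sub]
      ring
    · intro j hj
      have h1 := Finset.mem_erase.1 hj
      rw [if_neg (Finset.ne_of_mem_erase h1.2), if_neg h1.1, integral_avoids_mul_avoids p γ hkl]
  have hinner (k : Fin M) := Finset.sum_congr (M := ℝ) (s₁ := Finset.univ.erase k) rfl
    fun l hl => hterm k l (Finset.ne_of_mem_erase hl).symm
  simp_rw [hinner]
  have hM1 : 1 ≤ M := NeZero.one_le
  simp only [Finset.sum_const, Finset.card_erase_of_mem (Finset.mem_univ _), Finset.card_univ,
    Fintype.card_fin, nsmul_eq_mul]
  push_cast [hM1]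
  field_simp

theorem integral_deliveredCount {M n : ℕ} [NeZero M] (p γ : unitInterval) :
    ∫ ω, (deliveredCount ω : ℝ) ∂actionsLaw M n p γ =
      n * (p * (1 - γ) * (1 - p / M) ^ (n - 1)) := by
  simp_rw [cast_deliveredCount]
  rw [integral_finsetSum _ fun _ _ => .of_finite]
  simp [integral_deliv]

/-- The variance of the number of deliveries is at most its mean as soon as the transmission
probability is at most `M / n`. -/
theorem integral_deliveredCount_sq_le {M n : ℕ} [NeZero M] (p γ : unitInterval)
    (hp : (p : ℝ) * n ≤ M) :
    ∫ ω, (deliveredCount ω : ℝ) ^ 2 ∂actionsLaw M n p γ ≤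
      n * (p * (1 - γ) * (1 - p / M) ^ (n - 1)) +
      (n * (p * (1 - γ) * (1 - p / M) ^ (n - 1))) ^ 2 := by
  have hM : (0 : ℝ) < M := Nat.cast_pos.2 (NeZero.pos M)
  have hM1 : (1 : ℝ) ≤ M := by exact_mod_cast (NeZero.one_le : 1 ≤ M)
  have hidem (ω : Fin n → Action M) (i : Fin n) : deliv ω i * deliv ω i = deliv ω i := by
    unfold deliv; split_ifs <;> simp
  have hsq (ω : Fin n → Action M) : (deliveredCount ω : ℝ) ^ 2 =
      deliveredCount ω + ∑ i, ∑ i' ∈ Finset.univ.erase i, deliv ω i * deliv ω i' := by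
    rw [cast_deliveredCount, sq, Finset.sum_mul_sum, ← Finset.sum_add_distrib]
    refine Finset.sum_congr rfl fun i _ => ?_
    rw [← Finset.add_sum_erase _ _ (Finset.mem_univ i), hidem]
  simp_rw [hsq]
  rw [integral_add .of_finite .of_finite, integral_deliveredCount,
    integral_finsetSum _ fun _ _ => .of_finite]
  simp_rw [integral_finsetSum _ fun _ _ => Integrable.of_finite (μ := actionsLaw M n p γ)]
  gcongr
  have hpair (i : Fin n) := Finset.sum_le_sum fun i' (hi' : i' ∈ Finset.univ.erase i) =>
    integral_deliv_mul_deliv_le (M := M) p γ (Finset.ne_of_mem_erase hi')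
  refine (Finset.sum_le_sum fun i _ => hpair i).trans ?_
  simp only [Finset.sum_const, Finset.card_erase_of_mem (Finset.mem_univ _), Finset.card_univ,
    Fintype.card_fin, nsmul_eq_mul]
  rcases lt_or_ge n 2 with hn | hn
  · have : (n : ℝ) * ((n - 1 : ℕ) : ℝ) = 0 := by interval_cases n <;> simp
    rw [← mul_assoc, this, zero_mul]
    positivity
  obtain ⟨m, rfl⟩ : ∃ m, n = m + 2 := ⟨n - 2, by omega⟩
  set q : ℝ := p / M with hq
  have hp0 : (0 : ℝ) ≤ p := p.2.1
  have hp1 : (p : ℝ) ≤ 1 := p.2.2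
  have hq0 : 0 ≤ q := by positivity
  have hqM : q ≤ 1 / M := by rw [hq]; gcongr
  push_cast at hp
  have hqn : q * (m + 2) ≤ 1 := by
    rw [hq, div_mul_eq_mul_div, div_le_one hM]; exact hp
  have hm0 : (0 : ℝ) ≤ m := m.cast_nonneg
  have hq2 : 2 * q ≤ 1 := by nlinarith
  have e1 : m + 2 - 1 = m + 1 := rfl
  have e2 : m + 2 - 2 = m := rfl
  rw [e1, e2]
  push_cast
  have hA : (m + 1 : ℝ) ≤ (m + 2) * (1 - q) := by linarith
  have hB : 1 - 1 / (M : ℝ) ≤ 1 - q := by linarith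
  have hB0 : 0 ≤ 1 - 1 / (M : ℝ) := by
    rw [sub_nonneg, div_le_one hM]; exact hM1
  have hC : (1 - 2 * q) ^ m ≤ ((1 - q) ^ m) ^ 2 := by
    rw [pow_right_comm]
    apply pow_le_pow_left₀ (by linarith)
    nlinarith [sq_nonneg q]
  calc (m + 2 : ℝ) * ((m + 1) * ((p * (1 - γ)) ^ 2 * (1 - 1 / M) * (1 - 2 * q) ^ m))
      ≤ (m + 2) * (((m + 2) * (1 - q)) * ((p * (1 - γ)) ^ 2 * (1 - q) * ((1 - q) ^ m) ^ 2)) := by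
        have : 0 ≤ (1 - 2 * q) ^ m := pow_nonneg (by linarith) _
        have : 0 ≤ 1 - q := by linarith
        gcongr
    _ = _ := by ring

/-! ### The limiting throughput function -/

/-- The limiting number, per channel, of transmissions that are alone on their channel, when there
are `x` active devices per channel. The minimum is the number of transmitting devices per channel:
the algorithm thins a load above `1` to `1`. -/
noncomputable def throughput (x : ℝ) : ℝ := min x 1 * Real.exp (-min x 1)

theorem hasDerivAt_mul_exp_neg (x : ℝ) :
    HasDerivAt (fun x : ℝ => x * Real.exp (-x)) ((1 - x) * Real.exp (-x)) x := by
  have h := (hasDerivAt_id' x).mul (hasDerivAt_neg x).exp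
  exact h.congr_deriv (by ring)

theorem strictMonoOn_mul_exp_neg : StrictMonoOn (fun x : ℝ => x * Real.exp (-x)) (Set.Iic 1) := by
  refine strictMonoOn_of_deriv_pos (convex_Iic _) (by fun_prop) fun x hx => ?_
  rw [interior_Iic, Set.mem_Iio] at hx
  rw [(hasDerivAt_mul_exp_neg x).deriv]
  exact mul_pos (by linarith) (Real.exp_pos _)

theorem monotoneOn_sub_mul_exp_neg :
    MonotoneOn (fun x : ℝ => x - x * Real.exp (-x)) (Set.Ici 0) := by
  refine monotoneOn_of_deriv_nonneg (convex_Ici _) (by fun_prop) (by fun_prop) fun x hx => ?_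
  rw [interior_Ici, Set.mem_Ioi] at hx
  have hd : HasDerivAt (fun x : ℝ => x - x * Real.exp (-x)) (1 - (1 - x) * Real.exp (-x)) x :=
    (hasDerivAt_id x).sub (hasDerivAt_mul_exp_neg x)
  rw [hd.deriv]
  have : Real.exp (-x) ≤ 1 := Real.exp_le_one_iff.2 (by linarith)
  nlinarith [Real.exp_pos (-x)]

theorem throughput_mono {x y : ℝ} (h : x ≤ y) : throughput x ≤ throughput y :=
  strictMonoOn_mul_exp_neg.monotoneOn (Set.mem_Iic.2 (min_le_right _ _))
    (Set.mem_Iic.2 (min_le_right _ _))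
    (min_le_min_right 1 h)

theorem throughput_lt {x y : ℝ} (h : x < y) (hx : x < 1) : throughput x < throughput y :=
  strictMonoOn_mul_exp_neg (Set.mem_Iic.2 (min_le_right _ _))
    (Set.mem_Iic.2 (min_le_right _ _))
    (lt_min (min_lt_of_left_lt h) (min_lt_of_left_lt hx))

theorem throughput_sub_le {x y : ℝ} (hx : 0 ≤ x) (h : x ≤ y) :
    throughput y - throughput x ≤ y - x := by
  have h1 := monotoneOn_sub_mul_exp_neg (Set.mem_Ici.2 (le_min hx zero_le_one))
    (Set.mem_Ici.2 (le_min (hx.trans h) zero_le_one)) (min_le_min_right 1 h)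
  have h2 : min y 1 - min x 1 ≤ y - x := by
    rcases le_total y 1 with hy | hy
    · rw [min_eq_left hy, min_eq_left (h.trans hy)]
    · rw [min_eq_right hy]
      rcases le_total x 1 with hx | hx
      · rw [min_eq_left hx]; linarith
      · rw [min_eq_right hx]; linarith
  unfold throughput
  simp only at h1
  linarith

theorem throughput_nonneg {x : ℝ} (hx : 0 ≤ x) : 0 ≤ throughput x :=
  mul_nonneg (le_min hx zero_le_one) (Real.exp_pos _).le

theorem throughput_le (x : ℝ) : throughput x ≤ Real.exp (-1) := by
  have := strictMonoOn_mul_exp_neg.monotoneOn (Set.mem_Iic.2 (min_le_right x 1))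
    (Set.mem_Iic.2 le_rfl) (min_le_right x 1)
  simp only [one_mul] at this
  exact this

/-- The throughput stays away from its value at `x₀ < 1` when `x` stays away from `x₀`. -/
theorem exists_le_abs_throughput_sub {x₀ ε : ℝ} (hx₀ : x₀ < 1) (hε : 0 < ε) :
    ∃ δ > 0, ∀ x, ε ≤ |x - x₀| → δ ≤ |throughput x - throughput x₀| := by
  refine ⟨min (throughput (x₀ + ε) - throughput x₀) (throughput x₀ - throughput (x₀ - ε)),
    lt_min (sub_pos.2 (throughput_lt (by linarith) hx₀))
      (sub_pos.2 (throughput_lt (by linarith) (by linarith))), fun x hx => ?_⟩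
  rcases le_abs.1 hx with h | h
  · refine (min_le_left _ _).trans (le_trans ?_ (le_abs_self _))
    linarith [throughput_mono (show x₀ + ε ≤ x by linarith)]
  · refine (min_le_right _ _).trans (le_trans ?_ (neg_le_abs _))
    linarith [throughput_mono (show x ≤ x₀ - ε by linarith)]

theorem exp_neg_mul_le_one_sub_pow {q : ℝ} {n : ℕ} (hq : 0 ≤ q) (hqn : q * (n + 1) ≤ 1) :
    Real.exp (-(q * (n + 1))) ≤ (1 - q) ^ n := by
  rcases Nat.eq_zero_or_pos n with rfl | hn
  · simpa using hq
  have hn1 : (1 : ℝ) ≤ n := by exact_mod_cast hn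
  have hq1 : 0 < 1 - q := by nlinarith
  have h1 : Real.exp (-(q / (1 - q))) ≤ 1 - q := by
    rw [Real.exp_neg, inv_le_comm₀ (Real.exp_pos _) hq1]
    refine le_trans (le_of_eq ?_) (Real.add_one_le_exp (q / (1 - q)))
    field_simp
    ring
  calc Real.exp (-(q * (n + 1))) ≤ Real.exp (-(q / (1 - q))) ^ n := by
        rw [← Real.exp_nat_mul, Real.exp_le_exp]
        have : (n : ℝ) * (q / (1 - q)) ≤ q * (n + 1) := by
          rw [mul_div_assoc', div_le_iff₀ hq1]
          nlinarith
        linarith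
    _ ≤ (1 - q) ^ n := pow_le_pow_left₀ (Real.exp_pos _).le h1 n

/-- The expected number of transmissions that are alone on their channel, when `n` devices are
active and follow the algorithm. -/
noncomputable def meanSingles (M n : ℕ) : ℝ :=
  n * (transmitProb M n * (1 - transmitProb M n / M) ^ (n - 1))

theorem transmitProb_mul_le (M n : ℕ) : (transmitProb M n : ℝ) * n ≤ M := by
  rcases Nat.eq_zero_or_pos n with rfl | hn
  · simp
  · have hn' : (0 : ℝ) < n := by exact_mod_cast hn
    calc (transmitProb M n : ℝ) * n ≤ (M / n) * n := by
          gcongr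
          exact min_le_right _ _
      _ = M := div_mul_cancel₀ _ hn'.ne'

/-- The throughput with finitely many channels agrees with its limit up to one device in total,
whatever the number of active devices. -/
theorem throughput_le_meanSingles {M : ℕ} (hM : 1 ≤ M) (n : ℕ) :
    M * throughput (n / M) ≤ meanSingles M n ∧
      meanSingles M n ≤ M * throughput (n / M) + 1 := by
  have hM0 : (0 : ℝ) < M := by exact_mod_cast hM
  rcases Nat.eq_zero_or_pos n with rfl | hn
  · simp [meanSingles, throughput]
  obtain ⟨n, rfl⟩ : ∃ k, n = k + 1 := ⟨n - 1, by omega⟩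
  have hn' : (0 : ℝ) < ((n + 1 : ℕ) : ℝ) := by positivity
  set q : ℝ := transmitProb M (n + 1) / M with hq
  have hq0 : 0 ≤ q := div_nonneg (transmitProb M (n + 1)).2.1 hM0.le
  set y : ℝ := min (((n + 1 : ℕ) : ℝ) / M) 1 with hy
  have hqy : q * (n + 1) = y := by
    rw [hq, hy, transmitProb, div_mul_eq_mul_div, mul_comm, mul_div_assoc]
    change _ * (min 1 _ / (M : ℝ)) = _
    have e : (n : ℝ) + 1 = ((n + 1 : ℕ) : ℝ) := by push_cast; ring
    rw [e, ← mul_div_assoc, mul_min_of_nonneg _ _ hn'.le, mul_one,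
      mul_div_cancel₀ _ hn'.ne', ← min_div_div_right hM0.le, div_self hM0.ne']
  have hy0 : 0 ≤ y := le_min (by positivity) zero_le_one
  have hy1 : y ≤ 1 := min_le_right _ _
  have hMq : M * q ≤ 1 := by
    rw [hq, mul_div_cancel₀ _ hM0.ne']; exact (transmitProb M (n + 1)).2.2
  have hmean : meanSingles M (n + 1) = M * (y * (1 - q) ^ n) := by
    rw [meanSingles, ← hq, ← hqy, hq]
    simp only [Nat.add_sub_cancel]
    push_cast
    field_simp
  have hf : throughput (((n + 1 : ℕ) : ℝ) / M) = y * Real.exp (-y) := rfl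
  rw [hmean, hf]
  constructor
  · gcongr
    rw [← hqy]
    exact exp_neg_mul_le_one_sub_pow hq0 (by rw [hqy]; exact hy1)
  · have hq1 : q ≤ 1 := by
      have : (1 : ℝ) ≤ M := by exact_mod_cast hM
      nlinarith
    have h1 : (1 - q) ^ n ≤ Real.exp (-y) * Real.exp q := by
      rw [← Real.exp_add, ← hqy, show -(q * ((n : ℝ) + 1)) + q = n * (-q) by ring,
        Real.exp_nat_mul]
      exact pow_le_pow_left₀ (by linarith) (Real.one_sub_le_exp_neg q) n
    -- `exp q - 1 ≤ q * exp q ≤ q * exp 1`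
    have h2 : Real.exp q ≤ 1 + q * Real.exp 1 := by
      have h3 := Real.one_sub_le_exp_neg q
      have h4 : Real.exp (-q) * Real.exp q = 1 := by rw [← Real.exp_add]; simp
      have h5 : Real.exp q ≤ Real.exp 1 := Real.exp_le_exp.2 hq1
      nlinarith [Real.exp_pos q]
    have h6 : y * Real.exp (-y) * Real.exp 1 ≤ 1 := by
      have h7 := strictMonoOn_mul_exp_neg.monotoneOn (Set.mem_Iic.2 hy1) (Set.mem_Iic.2 le_rfl) hy1
      simp only [one_mul] at h7
      calc _ ≤ Real.exp (-1) * Real.exp 1 := by gcongr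
        _ = 1 := by rw [← Real.exp_add]; simp
    calc M * (y * (1 - q) ^ n) ≤ M * (y * (Real.exp (-y) * (1 + q * Real.exp 1))) := by
          gcongr
          exact h1.trans (by gcongr)
      _ = M * (y * Real.exp (-y)) + M * q * (y * Real.exp (-y) * Real.exp 1) := by ring
      _ ≤ M * (y * Real.exp (-y)) + 1 := by
          gcongr
          exact mul_le_one₀ hMq (by positivity) h6

/-- The drift of the squared distance of `n` to `x₀ * M`, where `x₀ < 1`. Here
`c * meanSingles M n` is the mean number of departures and a bound for its variance, and
`c * throughput x₀ * M` is the mean number of arrivals. -/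
theorem exists_drift_bound {c x₀ ε : ℝ} (hc0 : 0 < c) (hc1 : c ≤ 1) (hx0 : 0 ≤ x₀) (hx1 : x₀ < 1)
    (hε : 0 < ε) :
    ∃ κ > 0, ∀ M : ℕ, 1 ≤ M → ∀ (n : ℕ),
      (n - x₀ * M - (c * meanSingles M n - c * throughput x₀ * M)) ^ 2 + c * meanSingles M n
        + κ * M * |n - x₀ * M| ≤ (n - x₀ * M) ^ 2 + 7 * M + κ * ε * M ^ 2 := by
  obtain ⟨δ, hδ, hδx⟩ := exists_le_abs_throughput_sub hx1 hε
  refine ⟨c * δ, by positivity, fun M hM n => ?_⟩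
  have hM0 : (0 : ℝ) < M := by exact_mod_cast hM
  have hM1 : (1 : ℝ) ≤ M := by exact_mod_cast hM
  obtain ⟨hg1, hg2⟩ := throughput_le_meanSingles hM n
  set x : ℝ := n / M with hx
  have hxn : (n : ℝ) = x * M := by rw [hx, div_mul_cancel₀ _ hM0.ne']
  have hx0' : 0 ≤ x := by positivity
  set d := throughput x - throughput x₀ with hd
  obtain ⟨e, he⟩ : ∃ e, e = c * meanSingles M n - c * (M * throughput x) := ⟨_, rfl⟩
  have he0 : 0 ≤ e := by rw [he, ← mul_sub]; exact mul_nonneg hc0.le (by linarith)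
  have he1 : e ≤ 1 := by rw [he, ← mul_sub]; nlinarith
  have hg : c * meanSingles M n = M * (c * throughput x) + e := by rw [he]; ring
  have hbase : Real.exp (-1) ≤ 1 := Real.exp_le_one_iff.2 (by norm_num)
  have hf1 := (throughput_le x).trans hbase
  have hf2 := (throughput_le x₀).trans hbase
  have hf0 := throughput_nonneg hx0'
  have hf0' := throughput_nonneg hx0
  have hδx' := hδx x
  clear_value x
  clear hδx hx hg1 hg2
  -- `d` and `x - x₀` have the same sign, and `|d| ≤ |x - x₀|`
  have hsign : |d| * |x - x₀| = d * (x - x₀) ∧ |d| ≤ |x - x₀| := by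
    rcases le_total x₀ x with h | h
    · have h1 := throughput_mono h
      have h2 := throughput_sub_le hx0 h
      rw [abs_of_nonneg (show 0 ≤ d by linarith), abs_of_nonneg (sub_nonneg.2 h)]
      exact ⟨rfl, h2⟩
    · have h1 := throughput_mono h
      have h2 := throughput_sub_le hx0' h
      rw [abs_of_nonpos (show d ≤ 0 by linarith), abs_of_nonpos (sub_nonpos.2 h)]
      exact ⟨by ring, by linarith⟩
  rw [← hd] at hδx'
  clear_value d
  have hd1 : |d| ≤ 1 := by rw [abs_le]; constructor <;> linarith
  have hκ : δ * |x - x₀| ≤ d * (x - x₀) + δ * ε := by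
    rw [← hsign.1]
    rcases le_or_gt ε |x - x₀| with h | h
    · have := mul_le_mul_of_nonneg_right (hδx' h) (abs_nonneg (x - x₀))
      linarith [mul_pos hδ hε]
    · have h1 : 0 ≤ |d| * |x - x₀| := by positivity
      linarith [mul_le_mul_of_nonneg_left h.le hδ.le]
  have hsq : c ^ 2 * d ^ 2 ≤ c * (d * (x - x₀)) := by
    rw [← hsign.1, ← sq_abs d]
    have h1 : |d| ^ 2 ≤ |d| * |x - x₀| := by
      rw [sq]; exact mul_le_mul_of_nonneg_left hsign.2 (abs_nonneg d)
    have h2 : c ^ 2 ≤ c := by nlinarith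
    have : 0 ≤ |d| ^ 2 := by positivity
    nlinarith
  have habs : |(n : ℝ) - x₀ * M| = M * |x - x₀| := by
    rw [hxn, ← sub_mul, abs_mul, abs_of_pos hM0, mul_comm]
  have hde : d * e * c ≤ 1 := by
    have h1 : d * e ≤ 1 := by nlinarith [le_abs_self d]
    nlinarith
  have hxe : -1 ≤ (x - x₀) * e := by
    have := mul_nonneg (show 0 ≤ x - x₀ + 1 by linarith) he0
    linarith
  have hcg : c * meanSingles M n ≤ 2 * M := by
    rw [hg]
    have := mul_le_mul_of_nonneg_left (mul_le_one₀ hc1 hf0 hf1) hM0.le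
    linarith
  have key : (n - x₀ * M - (c * meanSingles M n - c * throughput x₀ * M)) ^ 2 =
      (n - x₀ * M) ^ 2 + M ^ 2 * (-2 * (c * (d * (x - x₀))) + c ^ 2 * d ^ 2)
        - 2 * M * ((x - x₀) * e) + 2 * M * (d * e * c) + e ^ 2 := by
    rw [hg, hxn, hd]; ring
  rw [key, habs]
  have t1 : M ^ 2 * (-2 * (c * (d * (x - x₀))) + c ^ 2 * d ^ 2) ≤
      M ^ 2 * (-(c * (d * (x - x₀)))) := by
    gcongr; linarith
  have t2 : c * δ * M * (M * |x - x₀|) ≤ M ^ 2 * (c * (d * (x - x₀) + δ * ε)) := by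
    have := mul_le_mul_of_nonneg_left hκ (show 0 ≤ (M : ℝ) ^ 2 * c by positivity)
    linarith
  have t3 := mul_le_mul_of_nonneg_left hxe (show 0 ≤ 2 * (M : ℝ) by positivity)
  have t4 := mul_le_mul_of_nonneg_left hde (show 0 ≤ 2 * (M : ℝ) by positivity)
  have t5 : e ^ 2 ≤ M := (pow_le_one₀ he0 he1).trans hM1
  linarith

/-! ### Moments of the Poisson law -/

open Nat in
/-- The identity `E (N * f N) = r * E (f (N + 1))` for a Poisson variable `N` of mean `r`. -/
theorem hasSum_poisson_shift {r a : ℝ} {f : ℕ → ℝ}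
    (h : HasSum (fun n : ℕ => Real.exp (-r) * r ^ n / n ! * f (n + 1)) a) :
    HasSum (fun n : ℕ => Real.exp (-r) * r ^ n / n ! * (n * f n)) (r * a) := by
  rw [← hasSum_nat_add_iff' 1]
  simp only [Finset.range_one, Finset.sum_singleton, CharP.cast_eq_zero, zero_mul, mul_zero,
    sub_zero]
  refine (h.mul_left r).congr_fun fun n => ?_
  rw [Nat.factorial_succ]
  push_cast
  have : ((n : ℝ) + 1) ≠ 0 := by positivity
  field_simp
  ring

theorem poisson_moments (r : ℝ≥0) (β : ℝ) :
    Integrable (fun a : ℕ => ((a : ℝ) + β) ^ 2) (poissonMeasure r) ∧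
    Integrable (fun a : ℕ => (a : ℝ)) (poissonMeasure r) ∧
    ∫ a : ℕ, ((a : ℝ) + β) ^ 2 ∂poissonMeasure r = (β + r) ^ 2 + r ∧
    ∫ a : ℕ, (a : ℝ) ∂poissonMeasure r = r := by
  have h0 := hasSum_one_poissonMeasure r
  have h1 := hasSum_poisson_shift (r := (r : ℝ)) (f := fun _ => 1) (by simpa using h0)
  have h2 := hasSum_poisson_shift (r := (r : ℝ)) (f := fun n => (n : ℝ) - 1) (by simpa using h1)
  simp only [mul_one] at h1 h2
  have h3 := (h2.add (h1.mul_left (1 + 2 * β))).add (h0.mul_left (β ^ 2))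
  have h4 : HasSum (fun n : ℕ => Real.exp (-r) * r ^ n / n.factorial * ((n : ℝ) + β) ^ 2)
      ((β + r) ^ 2 + r) := by
    convert h3 using 1
    · ext n; ring
    · ring
  have i4 : Integrable (fun a : ℕ => ((a : ℝ) + β) ^ 2) (poissonMeasure r) := by
    rw [integrable_poissonMeasure_iff]
    simpa using h4.summable
  have i1 : Integrable (fun a : ℕ => (a : ℝ)) (poissonMeasure r) := by
    rw [integrable_poissonMeasure_iff]
    simpa using h1.summable
  refine ⟨i4, i1, ?_, ?_⟩
  · rw [integral_poissonMeasure]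
    exact h4.tsum_eq
  · rw [integral_poissonMeasure]
    exact h1.tsum_eq

/-! ### The drift of the backlog -/

theorem isProbabilityMeasure_slotLaw {M : ℕ} (hM : 1 ≤ M) (γ : unitInterval) (n : ℕ) :
    IsProbabilityMeasure (slotLaw M γ n) := by
  have : NeZero M := ⟨by omega⟩
  exact Measure.isProbabilityMeasure_map Measurable.of_discrete.aemeasurable

theorem backlogKernel_apply (M : ℕ) (γ : unitInterval) (lam : ℝ≥0) (b : ℕ) :
    backlogKernel M γ lam b =
      (poissonMeasure (lam * M)).bind fun a => slotLaw M γ (b + a) := rfl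

theorem isMarkovKernel_backlogKernel {M : ℕ} (hM : 1 ≤ M) (γ : unitInterval) (lam : ℝ≥0) :
    IsMarkovKernel (backlogKernel M γ lam) := by
  have := isProbabilityMeasure_slotLaw hM γ
  refine ⟨fun b => ⟨?_⟩⟩
  rw [backlogKernel_apply, Measure.bind_apply .univ Measurable.of_discrete.aemeasurable]
  simp

theorem lintegral_backlogKernel (M : ℕ) (γ : unitInterval) (lam : ℝ≥0) (b : ℕ) (f : ℕ → ℝ≥0∞) :
    ∫⁻ k, f k ∂backlogKernel M γ lam b =
      ∫⁻ a, ∫⁻ k, f k ∂slotLaw M γ (b + a) ∂poissonMeasure (lam * M) := by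
  rw [backlogKernel_apply, Measure.lintegral_bind Measurable.of_discrete.aemeasurable
    Measurable.of_discrete.aemeasurable]

/-- The second moment of the remaining backlog about a point `s`, as its squared mean plus a
variance that is at most the mean number of deliveries. -/
theorem lintegral_slotLaw_sq_le {M : ℕ} (hM : 1 ≤ M) (γ : unitInterval) (n : ℕ) (s : ℝ) :
    ∫⁻ k : ℕ, ENNReal.ofReal (((k : ℝ) - s) ^ 2) ∂slotLaw M γ n ≤
      ENNReal.ofReal ((n - s - (1 - γ) * meanSingles M n) ^ 2 + (1 - γ) * meanSingles M n) := by
  have : NeZero M := ⟨by omega⟩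
  have h1 := integral_deliveredCount (M := M) (n := n) (transmitProb M n) γ
  have h2 := integral_deliveredCount_sq_le (M := M) (n := n) (transmitProb M n) γ
    (transmitProb_mul_le M n)
  have e : (n : ℝ) * (transmitProb M n * (1 - γ) * (1 - transmitProb M n / M) ^ (n - 1)) =
      (1 - γ) * meanSingles M n := by rw [meanSingles]; ring
  rw [e] at h1 h2
  rw [slotLaw, lintegral_map Measurable.of_discrete Measurable.of_discrete,
    ← ofReal_integral_eq_lintegral_ofReal .of_finite (ae_of_all _ fun ω => sq_nonneg _)]
  apply ENNReal.ofReal_le_ofReal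
  have hexp (ω : Fin n → Action M) : (((n - deliveredCount ω : ℕ) : ℝ) - s) ^ 2 =
      (n - s) ^ 2 + (-2 * (n - s)) * deliveredCount ω + (deliveredCount ω : ℝ) ^ 2 := by
    rw [Nat.cast_sub (deliveredCount_le ω)]; ring
  simp_rw [hexp]
  rw [integral_add .of_finite .of_finite, integral_add .of_finite .of_finite, integral_const_mul,
    h1]
  simp only [integral_const, probReal_univ, one_smul]
  linarith

/-- The Foster–Lyapunov inequality of the backlog, for the squared distance to `η * M`, where `η`
is the equilibrium backlog per channel. -/
theorem exists_drift_backlogKernel {γ : unitInterval} {lam : ℝ≥0} {x₀ ε : ℝ}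
    (hγ : (γ : ℝ) < 1) (hx0 : 0 ≤ x₀) (hx1 : x₀ < 1)
    (hlam : (1 - γ) * throughput x₀ = lam) (hε : 0 < ε) :
    ∃ κ > 0, ∀ M : ℕ, 1 ≤ M → ∀ b : ℕ,
      ∫⁻ k : ℕ, ENNReal.ofReal (((k : ℝ) - (x₀ - lam) * M) ^ 2) ∂backlogKernel M γ lam b +
        ENNReal.ofReal (κ * M * |b - (x₀ - lam) * M|) ≤
      ENNReal.ofReal ((b - (x₀ - lam) * M) ^ 2) +
        ENNReal.ofReal ((7 + lam) * M + κ * ε * M ^ 2) := by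
  obtain ⟨κ, hκ, hdrift⟩ := exists_drift_bound (c := 1 - γ) (sub_pos.2 hγ)
    (by linarith [γ.2.1]) hx0 hx1 hε
  refine ⟨κ, hκ, fun M hM b => ?_⟩
  set r : ℝ≥0 := lam * M with hr
  have hrc : (r : ℝ) = lam * M := by rw [hr]; push_cast; rfl
  set β : ℝ := b - x₀ * M with hβ
  have hβr : b - (x₀ - lam) * M = β + r := by rw [hβ, hrc]; ring
  obtain ⟨isq, iid, esq, eid⟩ := poisson_moments r β
  have habs : ENNReal.ofReal (κ * M * |β + r|) ≤
      ∫⁻ a : ℕ, ENNReal.ofReal (κ * M * |(a : ℝ) + β|) ∂poissonMeasure r := by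
    have iab : Integrable (fun a : ℕ => (a : ℝ) + β) (poissonMeasure r) :=
      iid.add (integrable_const β)
    rw [← ofReal_integral_eq_lintegral_ofReal (iab.abs.const_mul _)
      (ae_of_all _ fun a => by positivity), integral_const_mul]
    apply ENNReal.ofReal_le_ofReal
    gcongr
    have h1 : ∫ a : ℕ, ((a : ℝ) + β) ∂poissonMeasure r = β + r := by
      rw [integral_add iid (integrable_const β), eid]
      simp [add_comm]
    rw [← h1]
    exact abs_integral_le_integral_abs
  have hpt (a : ℕ) : ∫⁻ k : ℕ, ENNReal.ofReal (((k : ℝ) - (x₀ - lam) * M) ^ 2)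
        ∂slotLaw M γ (b + a) + ENNReal.ofReal (κ * M * |(a : ℝ) + β|) ≤
      ENNReal.ofReal (((a : ℝ) + β) ^ 2 + (7 * M + κ * ε * M ^ 2)) := by
    refine (add_le_add_left (lintegral_slotLaw_sq_le hM γ (b + a) _) _).trans ?_
    have hms : 0 ≤ meanSingles M (b + a) :=
      (mul_nonneg M.cast_nonneg (throughput_nonneg (by positivity))).trans
        (throughput_le_meanSingles hM _).1
    have hg0 : 0 ≤ (1 - (γ : ℝ)) * meanSingles M (b + a) :=
      mul_nonneg (sub_nonneg.2 hγ.le) hms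
    rw [← ENNReal.ofReal_add (by positivity) (by positivity)]
    apply ENNReal.ofReal_le_ofReal
    have h1 := hdrift M hM (b + a)
    rw [hlam] at h1
    have e1 : ((b + a : ℕ) : ℝ) - x₀ * M = a + β := by rw [hβ]; push_cast; ring
    have e2 : ((b + a : ℕ) : ℝ) - (x₀ - lam) * M - (1 - γ) * meanSingles M (b + a) =
        a + β - ((1 - γ) * meanSingles M (b + a) - lam * M) := by rw [← e1]; ring
    rw [e1] at h1
    rw [e2]
    linarith
  rw [lintegral_backlogKernel, hβr]
  refine (add_le_add_right habs _).trans ?_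
  rw [← lintegral_add_left Measurable.of_discrete]
  refine (lintegral_mono hpt).trans ?_
  have isum : Integrable (fun a : ℕ => ((a : ℝ) + β) ^ 2 + (7 * M + κ * ε * M ^ 2))
      (poissonMeasure r) := isq.add (integrable_const _)
  rw [← hr, ← ofReal_integral_eq_lintegral_ofReal isum
    (ae_of_all _ fun a => by positivity), integral_add isq (integrable_const _), esq,
    ← ENNReal.ofReal_add (by positivity) (by positivity)]
  apply ENNReal.ofReal_le_ofReal
  rw [hrc]
  simp
  linarith

/-- From a positive backlog, the backlog decreases in one slot with positive probability: no device
is activated and a message is delivered. -/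
theorem exists_lt_backlogKernel_ne_zero {M : ℕ} (hM : 1 ≤ M) {γ : unitInterval} (hγ : (γ : ℝ) < 1)
    (lam : ℝ≥0) {b : ℕ} (hb : b ≠ 0) : ∃ c < b, backlogKernel M γ lam b {c} ≠ 0 := by
  have : NeZero M := ⟨by omega⟩
  have hM0 : (0 : ℝ) < M := by exact_mod_cast hM
  by_contra! hcon
  have h1 : backlogKernel M γ lam b (Set.Iio b) = 0 := by
    rw [← Set.biUnion_of_singleton (Set.Iio b)]
    exact (measure_biUnion_null_iff (Set.to_countable _)).2 hcon
  rw [backlogKernel_apply, Measure.bind_apply .of_discrete Measurable.of_discrete.aemeasurable,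
    lintegral_countable', ENNReal.tsum_eq_zero] at h1
  have h2 := (mul_eq_zero.1 (h1 0)).resolve_right (by
    rw [poissonMeasure_singleton]
    simpa using Real.exp_pos _)
  rw [add_zero, slotLaw, Measure.map_apply Measurable.of_discrete .of_discrete] at h2
  have h3 : ∀ᵐ ω ∂actionsLaw M b (transmitProb M b) γ, (deliveredCount ω : ℝ) = 0 := by
    rw [ae_iff]
    refine measure_mono_null (fun ω hω => ?_) h2
    have : deliveredCount ω ≠ 0 := by simpa using hω
    simp only [Set.mem_preimage, Set.mem_Iio]
    omega
  have h4 := integral_deliveredCount (M := M) (n := b) (transmitProb M b) γ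
  rw [integral_eq_zero_of_ae h3] at h4
  have e : (b : ℝ) * (transmitProb M b * (1 - γ) * (1 - transmitProb M b / M) ^ (b - 1)) =
      (1 - γ) * meanSingles M b := by rw [meanSingles]; ring
  have h5 : 0 < throughput (b / M) := by
    have hb' : (0 : ℝ) < b := by exact_mod_cast Nat.pos_of_ne_zero hb
    exact mul_pos (lt_min (by positivity) one_pos) (Real.exp_pos _)
  have h6 : 0 < meanSingles M b :=
    (mul_pos hM0 h5).trans_le (throughput_le_meanSingles hM b).1
  rw [e] at h4
  exact (mul_pos (sub_pos.2 hγ) h6).ne h4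

/-! ### The stationary backlog -/

/-- For every number of channels there is a stationary law whose mean distance to the equilibrium
`(x₀ - λ) * M` is controlled by each of the drift inequalities. -/
theorem exists_stationary {γ : unitInterval} {lam : ℝ≥0} {x₀ : ℝ}
    (hγ : (γ : ℝ) < 1) (hx0 : 0 ≤ x₀) (hx1 : x₀ < 1)
    (hlam : (1 - γ) * throughput x₀ = lam) {M : ℕ} (hM : 1 ≤ M) :
    ∃ π : Measure ℕ, IsStationary M γ lam π ∧ ∀ κ ε : ℝ,
      (∀ b : ℕ,
        ∫⁻ k : ℕ, ENNReal.ofReal (((k : ℝ) - (x₀ - lam) * M) ^ 2) ∂backlogKernel M γ lam b +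
          ENNReal.ofReal (κ * M * |b - (x₀ - lam) * M|) ≤
        ENNReal.ofReal ((b - (x₀ - lam) * M) ^ 2) +
          ENNReal.ofReal ((7 + lam) * M + κ * ε * M ^ 2)) →
      ∫⁻ b : ℕ, ENNReal.ofReal (κ * M * |b - (x₀ - lam) * M|) ∂π ≤
        ENNReal.ofReal ((7 + lam) * M + κ * ε * M ^ 2) := by
  have hM0 : (0 : ℝ) < M := by exact_mod_cast hM
  have := isMarkovKernel_backlogKernel hM γ lam
  obtain ⟨κ, hκ, hd⟩ := exists_drift_backlogKernel hγ hx0 hx1 hlam one_pos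
  have hfin (R : ℕ) : {b : ℕ | ENNReal.ofReal (κ * M * |b - (x₀ - lam) * M|) < R}.Finite := by
    refine (Set.finite_Iio ⌈(R : ℝ) / (κ * M) + (x₀ - lam) * M⌉₊).subset fun b hb => ?_
    rw [Set.mem_ofPred_eq, ← ENNReal.ofReal_natCast,
      ENNReal.ofReal_lt_ofReal_iff_of_nonneg (by positivity)] at hb
    rw [Set.mem_Iio, Nat.lt_ceil]
    have h1 : |(b : ℝ) - (x₀ - lam) * M| < R / (κ * M) := by
      rw [lt_div_iff₀ (by positivity)]; linarith
    linarith [le_abs_self ((b : ℝ) - (x₀ - lam) * M)]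
  obtain ⟨π, hπ, hinv, hW⟩ := CountableChain.exists_invariant_of_drift (backlogKernel M γ lam)
    (V₀ := fun b : ℕ => ENNReal.ofReal ((b - (x₀ - lam) * M) ^ 2)) ENNReal.ofReal_ne_top
    ENNReal.ofReal_ne_top hfin (hd M hM)
  exact ⟨π, ⟨hπ, hinv⟩, fun κ ε hd => hW _ _ _ ENNReal.ofReal_ne_top
    (fun b => ENNReal.ofReal_ne_top) hd⟩

theorem integrable_of_lintegral_dist {π : Measure ℕ} [IsProbabilityMeasure π] {κ s C : ℝ}
    (hκ : 0 < κ) (hC : 0 ≤ C)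
    (h : ∫⁻ b : ℕ, ENNReal.ofReal (κ * |b - s|) ∂π ≤ ENNReal.ofReal C) :
    Integrable (fun b : ℕ => (b : ℝ)) π ∧ κ * |∫ b : ℕ, (b : ℝ) ∂π - s| ≤ C := by
  have i1 : Integrable (fun b : ℕ => κ * |(b : ℝ) - s|) π := by
    refine ⟨Measurable.of_discrete.aestronglyMeasurable, ?_⟩
    rw [hasFiniteIntegral_iff_ofReal (ae_of_all _ fun b => by positivity)]
    exact h.trans_lt ENNReal.ofReal_lt_top
  have i2 : Integrable (fun b : ℕ => (b : ℝ) - s) π := by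
    have h1 := i1.const_mul κ⁻¹
    simp only [inv_mul_cancel_left₀ hκ.ne'] at h1
    exact (integrable_norm_iff Measurable.of_discrete.aestronglyMeasurable).1 h1
  have i3 : Integrable (fun b : ℕ => (b : ℝ)) π := by
    exact (i2.add (integrable_const s)).congr (ae_of_all _ fun b => by simp)
  refine ⟨i3, ?_⟩
  rw [← ofReal_integral_eq_lintegral_ofReal i1 (ae_of_all _ fun b => by positivity),
    ENNReal.ofReal_le_ofReal_iff hC, integral_const_mul] at h
  refine le_trans ?_ h
  gcongr
  have h2 : ∫ b : ℕ, (b : ℝ) ∂π - s = ∫ b : ℕ, ((b : ℝ) - s) ∂π := by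
    rw [integral_sub i3 (integrable_const s)]; simp
  rw [h2]
  exact abs_integral_le_integral_abs

/-- The number of active devices per channel in equilibrium solves `(1 - γ) x exp (-x) = λ`. -/
theorem throughput_neg_lambertW {γ : unitInterval} {lam : ℝ≥0}
    (hlam : (lam : ℝ) < (1 - (γ : ℝ)) * Real.exp (-1)) (hγ : (γ : ℝ) < 1) :
    0 ≤ -lambertW (-(lam : ℝ) / (1 - (γ : ℝ))) ∧ -lambertW (-(lam : ℝ) / (1 - (γ : ℝ))) < 1 ∧
      (1 - γ) * throughput (-lambertW (-(lam : ℝ) / (1 - (γ : ℝ)))) = lam := by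
  have hc : 0 < 1 - (γ : ℝ) := sub_pos.2 hγ
  have hlt : -Real.exp (-1) < -(lam : ℝ) / (1 - (γ : ℝ)) := by
    rw [lt_div_iff₀ hc]; linarith
  obtain ⟨h1, h2⟩ := lambertW_spec hlt.le
  set w := lambertW (-(lam : ℝ) / (1 - (γ : ℝ)))
  have hw0 : w ≤ 0 := by
    by_contra! hw
    have h3 : 0 < w * Real.exp w := mul_pos hw (Real.exp_pos w)
    rw [h2, neg_div, neg_pos] at h3
    exact absurd h3 (not_lt.2 (div_nonneg lam.2 hc.le))
  have hw1 : -w < 1 := by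
    refine lt_of_le_of_ne (by linarith) fun h => ?_
    have h3 : w = -1 := by linarith
    rw [← h2, h3] at hlt
    linarith
  refine ⟨by linarith, hw1, ?_⟩
  rw [throughput, min_eq_left hw1.le, neg_neg, neg_mul, h2]
  field_simp

end RandomAccess

theorem theorem2 (γ : unitInterval) (lam : ℝ≥0)
    (hlam : (lam : ℝ) < (1 - (γ : ℝ)) * Real.exp (-1)) :
    ∃ π : ℕ → Measure ℕ,
      (∀ M : ℕ, 1 ≤ M →
        RandomAccess.IsStationary M γ lam (π M) ∧
        (∀ ν : Measure ℕ, RandomAccess.IsStationary M γ lam ν → ν = π M) ∧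
        Integrable (fun b : ℕ => (b : ℝ)) (π M)) ∧
      Tendsto (fun M : ℕ => (∫ b : ℕ, (b : ℝ) ∂(π M)) / M) atTop
        (𝓝 (-lambertW (-(lam : ℝ) / (1 - (γ : ℝ))) - lam)) := by
  have hγ : (γ : ℝ) < 1 := by
    by_contra! h
    have : (1 - (γ : ℝ)) * Real.exp (-1) ≤ 0 :=
      mul_nonpos_of_nonpos_of_nonneg (by linarith) (Real.exp_pos _).le
    linarith [lam.2]
  obtain ⟨hx0, hx1, hx⟩ := RandomAccess.throughput_neg_lambertW hlam hγ
  set x₀ := -lambertW (-(lam : ℝ) / (1 - (γ : ℝ)))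
  have hex := fun (M : ℕ) (hM : 1 ≤ M) => RandomAccess.exists_stationary hγ hx0 hx1 hx hM
  choose! π hπ hdist using hex
  -- For each `ε` there is `κ` such that `κ M |B_M - (x₀ - λ) M| ≤ (7 + λ) M + κ ε M ^ 2`.
  have hmean (ε : ℝ) (hε : 0 < ε) : ∃ κ > 0, ∀ M : ℕ, 1 ≤ M →
      Integrable (fun b : ℕ => (b : ℝ)) (π M) ∧
      κ * M * |∫ b : ℕ, (b : ℝ) ∂(π M) - (x₀ - lam) * M| ≤ (7 + lam) * M + κ * ε * M ^ 2 := by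
    obtain ⟨κ, hκ, hd⟩ := RandomAccess.exists_drift_backlogKernel hγ hx0 hx1 hx hε
    refine ⟨κ, hκ, fun M hM => ?_⟩
    have hM0 : (0 : ℝ) < M := by exact_mod_cast hM
    have := (hπ M hM).1
    exact RandomAccess.integrable_of_lintegral_dist (by positivity) (by positivity)
      (hdist M hM κ ε (hd M hM))
  refine ⟨π, fun M hM => ⟨hπ M hM, fun ν hν => ?_, ?_⟩, ?_⟩
  · have := RandomAccess.isMarkovKernel_backlogKernel hM γ lam
    have := hν.1
    have := (hπ M hM).1
    exact CountableChain.invariant_unique _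
      (fun b hb => RandomAccess.exists_lt_backlogKernel_ne_zero hM hγ lam hb) hν.2 (hπ M hM).2
  · obtain ⟨κ, -, h⟩ := hmean 1 one_pos
    exact (h M hM).1
  · rw [Metric.tendsto_atTop]
    intro ε hε
    obtain ⟨κ, hκ, h⟩ := hmean (ε / 2) (half_pos hε)
    obtain ⟨N, hN⟩ := exists_nat_gt ((7 + lam) / (κ * (ε / 2)))
    refine ⟨N + 1, fun M hM => ?_⟩
    have hM0 : (0 : ℝ) < M := by exact_mod_cast (by omega : 0 < M)
    have hNM : (N : ℝ) ≤ M := by exact_mod_cast (by omega : N ≤ M)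
    have h1 := (h M (by omega)).2
    have h2 : 7 + (lam : ℝ) < κ * (ε / 2) * M := by
      rw [div_lt_iff₀ (by positivity)] at hN
      nlinarith [show 0 < κ * (ε / 2) by positivity]
    rw [Real.dist_eq]
    have h3 : (∫ b : ℕ, (b : ℝ) ∂(π M)) / M - (x₀ - lam) =
        (∫ b : ℕ, (b : ℝ) ∂(π M) - (x₀ - lam) * M) / M := by field_simp
    rw [h3, abs_div, abs_of_pos hM0, div_lt_iff₀ hM0]
    have h4 : κ * M * |∫ b : ℕ, (b : ℝ) ∂(π M) - (x₀ - lam) * M| < κ * M * (ε * M) := by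
      nlinarith
    exact lt_of_mul_lt_mul_left h4 (by positivity)
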